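/- Let $n,m\ge 1$ be integers and let $q(z,w)=\sum_{j=0}^{n}\sum_{k=0}^{m}a_{jk}z^jw^k$ be a complex polynomial of degree at most $n$ in $z$ and at most $m$ in $w$, with no zeros on the closed bidisk $\overline{\mathbb D}^2$. Let $\sigma$ be normalized Lebesgue measure on $\mathbb T^2$ and let $$d\mu=\frac{c^2}{|q|^2}\,d\sigma ,$$ where $c>0$ is chosen so that $\mu$ is a probability measure. Write $\langle f,g\rangle_\mu=\int_{\mathbb T^2} f\bar g\,d\mu$, and for subspaces $V,W$ of $L^2(\mathbb T^2)$ let $V\ominus_\mu W=\{f\in V:\langle f,g\rangle_\mu=0\text{ for all }g\in W\}$. In the Hardy space $H^2(\mathbb T^2)$ define the closed subspaces $$\mathbf B=\overline{\operatorname{span}}\{z^jw^k: j,k\ge 0,\ j\le n-1\text{ or }k\le m-1\},$$ $$\mathbf{BB}=\overline{\operatorname{span}}\{z^jw^k: j\ge 0,\ 0\le k\le m-1\},\qquad \mathbf{LB}=\overline{\operatorname{span}}\{z^jw^k: k\ge 0,\ 0\le j\le n-1\}.$$ For integers $a,b\ge 0$ let $\mathcal P_{a,b}=\operatorname{span}\{z^jw^k:0\le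 j\le a,\ 0\le k\le b\}$, and let $\mathcal P_{n,m}^{\circ}=\operatorname{span}\{z^jw^k:0\le j\le n,\ 0\le k\le m,\ (j,k)\ne(n,m)\}$. Then $$\mathbf B\ominus_\mu\mathbf{BB}\subset \mathbf{LB}\ominus_\mu\mathcal P_{n-1,m-1},\qquad \mathbf B\ominus_\mu\mathbf{LB}\subset \mathbf{BB}\ominus_\mu\mathcal P_{n-1,m-1},$$ and $$\mathcal P_{n,m}^{\circ}\ominus_\mu\mathcal P_{n,m-1}=\mathcal P_{n-1,m}\ominus_\mu\mathcal P_{n-1,m-1},\qquad \mathcal P_{n,m}^{\circ}\ominus_\mu\mathcal P_{n-1,m}=\mathcal P_{n,m-1}\ominus_\mu\mathcal P_{n-1,m-1}.$$ -/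

import Mathlib

open MeasureTheory

noncomputable section

namespace BernsteinSzego

/-- The 2-torus, with `x = (s, t)` standing for the point `(z, w) = (exp (2πis), exp (2πit))`. -/
abbrev Torus : Type := UnitAddTorus (Fin 2)

/-- The point `(z, w)` of `ℂ²` that corresponds to a point of the 2-torus. -/
def torusPoint (x : Torus) : Fin 2 → ℂ := fun i => (AddCircle.toCircle (x i) : ℂ)

lemma continuous_torusPoint : Continuous torusPoint := by
  unfold torusPoint
  refine continuous_pi fun i => ?_
  exact continuous_subtype_val.comp (AddCircle.continuous_toCircle.comp (continuous_apply i))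

/-- Normalized Lebesgue measure on the 2-torus: the product of the Haar probability measures of
the two circles, i.e. `(2πi)⁻² (dz/z) (dw/w)`. -/
abbrev lebesgue : Measure Torus :=
  Measure.pi fun _ : Fin 2 => (AddCircle.haarAddCircle : Measure UnitAddCircle)

/-- The Hilbert space `L²(𝕋²)` for normalized Lebesgue measure. -/
abbrev L2 : Type := Lp ℂ 2 lebesgue

/-- The function `z ^ j * w ^ k` on the 2-torus. -/
def monomialMap (j k : ℕ) : C(Torus, ℂ) where
  toFun x := torusPoint x 0 ^ j * torusPoint x 1 ^ k
  continuous_toFun :=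
    (((continuous_apply 0).comp continuous_torusPoint).pow j).mul
      (((continuous_apply 1).comp continuous_torusPoint).pow k)

/-- The monomial `z ^ j * w ^ k` as an element of `L²(𝕋²)`. -/
def monomialL2 (j k : ℕ) : L2 := ContinuousMap.toLp (E := ℂ) 2 lebesgue ℂ (monomialMap j k)

/-- The linear span in `L²(𝕋²)` of the monomials `z ^ j * w ^ k` with `(j, k) ∈ S`. -/
def monomialSpan (S : Set (ℕ × ℕ)) : Submodule ℂ L2 :=
  Submodule.span ℂ ((fun p : ℕ × ℕ => monomialL2 p.1 p.2) '' S)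

/-- The closed linear span of the monomials `z ^ j * w ^ k` with `(j, k) ∈ S`. The Hardy space
`H²(𝕋²)` is the case `S = Set.univ`; as it is closed in `L²(𝕋²)`, closures taken in either of
the two spaces agree. -/
def monomialClosedSpan (S : Set (ℕ × ℕ)) : Submodule ℂ L2 :=
  (monomialSpan S).topologicalClosure

/-- The border subspace **B**. -/
def border (n m : ℕ) : Submodule ℂ L2 := monomialClosedSpan {p | p.1 < n ∨ p.2 < m}

/-- The bottom border subspace **BB**. -/
def bottomBorder (m : ℕ) : Submodule ℂ L2 := monomialClosedSpan {p | p.2 < m}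

/-- The left border subspace **LB**. -/
def leftBorder (n : ℕ) : Submodule ℂ L2 := monomialClosedSpan {p | p.1 < n}

/-- Polynomials of degree `(n, m)` without a `z ^ n * w ^ m` term (the box `[0,n] × [0,m]`
without its upper right corner). -/
def boxNoCorner (n m : ℕ) : Submodule ℂ L2 :=
  monomialSpan {p | p.1 ≤ n ∧ p.2 ≤ m ∧ p ≠ (n, m)}

/-- Polynomials of degree `(n, m - 1)` (the box without its upper row). -/
def boxNoTop (n m : ℕ) : Submodule ℂ L2 := monomialSpan {p | p.1 ≤ n ∧ p.2 < m}

/-- Polynomials of degree `(n - 1, m)` (the box without its right column). -/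
def boxNoRight (n m : ℕ) : Submodule ℂ L2 := monomialSpan {p | p.1 < n ∧ p.2 ≤ m}

/-- Polynomials of degree `(n - 1, m - 1)` (the box without its upper row and right column). -/
def boxSmall (n m : ℕ) : Submodule ℂ L2 := monomialSpan {p | p.1 < n ∧ p.2 < m}

/-- The measure `c² / |q|²` times normalized Lebesgue measure on the 2-torus. -/
def bsMeasure (q : MvPolynomial (Fin 2) ℂ) (c : ℝ) : Measure Torus :=
  lebesgue.withDensity fun x =>
    ENNReal.ofReal (c ^ 2 / ‖MvPolynomial.eval (torusPoint x) q‖ ^ 2)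

/-- The inner product `⟨f, g⟩_μ = ∫ f ḡ dμ`, for `f, g ∈ L²(𝕋²)` and a measure `μ` with a bounded
density with respect to Lebesgue measure. -/
def innerOf (μ : Measure Torus) (f g : L2) : ℂ := ∫ x, f x * (starRingEnd ℂ) (g x) ∂μ

/-- `V ⊖_μ W`: the elements of `V` that are orthogonal to `W` in the inner product of `μ`. -/
def ominus (μ : Measure Torus) (V W : Submodule ℂ L2) : Set L2 :=
  {f | f ∈ V ∧ ∀ g ∈ W, innerOf μ f g = 0}

end BernsteinSzego

end

/-! Division by `q` turns `⟨·, ·⟩_μ` into the inner product of `L²`, up to a constant. Since `q` has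
no zeros on the closed polydisk, `r = 1 / q` lies in the polydisk algebra: multiplication by `q` or
`r` only raises frequencies, multiplication by `q̄` or `r̄` only lowers them.

Let `h ∈ B / q` be orthogonal to `BB / q`. Then `f = r̄ h` has no frequencies `p` with `0 ≤ p₁` and
`0 ≤ p₂ < m`. Let `g` be the part of `f` with `0 ≤ p₁` and `p₂ < 0`. Multiplication by `q̄` lowers
`p₂` by at most `m`, so it cannot bring the frequencies of `f - g` into that quadrant, and
`q̄ f = h` has none there. Hence `q̄ g`, and with it `g = r̄ q̄ g`, has only frequencies with
`p₁ < 0`, so that `g = 0`. Thus `f` lives on `p₁ < 0` or `m ≤ p₂`, and `q f` on `p₁ < n` or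
`m ≤ p₂`. On the other hand `q f = r̄ (q h)` with `q h ∈ B` lives on `p₁ < n` or `p₂ < m`. Together
this leaves `p₁ < n`, which passes to `q h = q̄ (q f)`, so `q h ∈ LB`.

This inclusion `B ⊖ BB ⊆ LB` upgrades to the equality `B ⊖ BB = LB ⊖ (BB ∩ LB)` by the modular law.
It follows that `𝒫_{n-1,m} ⊖ 𝒫_{n-1,m-1}` is orthogonal to all of `BB`, in particular to
`𝒫_{n,m-1}`, and the modular law again gives the statement on polynomials. -/

noncomputable section

namespace BernsteinSzego

section OrthogonalComplements

variable {𝕜 E : Type*} [RCLike 𝕜] [NormedAddCommGroup E] [InnerProductSpace 𝕜 E]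

lemma inf_orthogonal_eq_inf_orthogonal_inf {B V L : Submodule 𝕜 E} [V.HasOrthogonalProjection]
    (hVB : V ≤ B) (hLB : L ≤ B) (h : B ⊓ Vᗮ ≤ L) : B ⊓ Vᗮ = L ⊓ (V ⊓ L)ᗮ := by
  have hL : L = (B ⊓ Vᗮ) ⊔ V ⊓ L := by
    rw [← sup_inf_assoc_of_le V h, sup_comm, inf_comm B,
      Submodule.sup_orthogonal_inf_of_hasOrthogonalProjection hVB, inf_eq_right.mpr hLB]
  have hV : B ⊓ Vᗮ ≤ (V ⊓ L)ᗮ := inf_le_right.trans (Submodule.orthogonal_le inf_le_left)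
  conv_rhs => enter [1]; rw [hL]
  rw [sup_inf_assoc_of_le _ hV, Submodule.inf_orthogonal_eq_bot, sup_bot_eq]

lemma sup_inf_orthogonal_eq_inf_orthogonal {V L S : Submodule 𝕜 E} [S.HasOrthogonalProjection]
    (hSV : S ≤ V) (hSL : S ≤ L) (h : L ⊓ Sᗮ ≤ Vᗮ) : (L ⊔ V) ⊓ Vᗮ = L ⊓ Sᗮ := by
  have hL : L ⊔ V = (L ⊓ Sᗮ) ⊔ V := by
    conv_lhs => rw [← Submodule.sup_orthogonal_inf_of_hasOrthogonalProjection hSL]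
    rw [sup_right_comm, sup_eq_right.mpr hSV, sup_comm, inf_comm]
  rw [hL, sup_inf_assoc_of_le _ h, Submodule.inf_orthogonal_eq_bot, sup_bot_eq]

end OrthogonalComplements

section Support

variable {ι 𝕜 E : Type*} [RCLike 𝕜] [NormedAddCommGroup E] [InnerProductSpace 𝕜 E]
  (b : HilbertBasis ι 𝕜 E)

/-- The vectors whose coordinates in the Hilbert basis `b` vanish off `S`. -/
def supported (S : Set ι) : Submodule 𝕜 E where
  carrier := {f | ∀ p ∉ S, b.repr f p = 0}
  add_mem' hf hg p hp := by simp [hf p hp, hg p hp]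
  zero_mem' := by simp
  smul_mem' a f hf p hp := by simp [hf p hp]

variable {b} {S S' : Set ι}

lemma mem_supported {f : E} : f ∈ supported b S ↔ ∀ p ∉ S, b.repr f p = 0 := Iff.rfl

lemma supported_mono (h : S ⊆ S') : supported b S ≤ supported b S' :=
  fun _ hf p hp => hf p fun hS => hp (h hS)

lemma basis_mem_supported {p : ι} (hp : p ∈ S) : b p ∈ supported b S := by
  classical
  intro p' hp'
  rw [b.repr_self, lp.single_apply_ne]
  rintro rfl
  exact hp' hp

variable (b S S')

lemma supported_empty : supported b ∅ = ⊥ := by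
  refine (Submodule.eq_bot_iff _).mpr fun f hf => b.repr.map_eq_zero_iff.mp ?_
  ext p
  exact hf p (Set.notMem_empty p)

lemma supported_inter : supported b (S ∩ S') = supported b S ⊓ supported b S' := by
  refine le_antisymm (le_inf (supported_mono Set.inter_subset_left)
    (supported_mono Set.inter_subset_right)) fun f hf p hp => ?_
  by_cases hpS : p ∈ S
  · exact hf.2 p fun hpS' => hp ⟨hpS, hpS'⟩
  · exact hf.1 p hpS

variable {S S'} in
lemma mem_supported_of_inter_subset {T : Set ι} {f : E} (hS : f ∈ supported b S)
    (hS' : f ∈ supported b S') (h : S ∩ S' ⊆ T) : f ∈ supported b T := by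
  refine supported_mono h ?_
  rw [supported_inter]
  exact ⟨hS, hS'⟩

lemma orthogonal_span_basis : (Submodule.span 𝕜 (b '' S))ᗮ = supported b Sᶜ := by
  ext f
  rw [← Submodule.span_singleton_le_iff_mem, ← Submodule.isOrtho_iff_le, Submodule.isOrtho_comm,
    Submodule.isOrtho_span, mem_supported]
  simp [b.repr_apply_apply]

lemma isClosed_supported : IsClosed (supported b S : Set E) := by
  rw [← compl_compl S, ← orthogonal_span_basis]
  exact Submodule.isClosed_orthogonal _

lemma orthogonal_supported : (supported b S)ᗮ = supported b Sᶜ := by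
  refine le_antisymm ?_ fun f hf g hg => ?_
  · rw [← orthogonal_span_basis]
    refine Submodule.orthogonal_le (Submodule.span_le.mpr ?_)
    rintro _ ⟨p, hp, rfl⟩
    exact basis_mem_supported hp
  · rw [← b.tsum_inner_mul_inner]
    refine (tsum_congr fun p => ?_).trans tsum_zero
    rw [← b.repr_apply_apply f, mul_eq_zero, inner_eq_zero_symm, ← b.repr_apply_apply g]
    exact (em (p ∈ S)).elim (fun hp => .inr (hf p (not_not.mpr hp))) fun hp => .inl (hg p hp)

variable [CompleteSpace E]

instance : (supported b S).HasOrthogonalProjection :=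
  have := (isClosed_supported b S).completeSpace_coe
  inferInstance

lemma supported_eq_topologicalClosure_span :
    supported b S = (Submodule.span 𝕜 (b '' S)).topologicalClosure := by
  rw [← Submodule.orthogonal_orthogonal_eq_closure, orthogonal_span_basis, orthogonal_supported,
    compl_compl]

lemma supported_union : supported b (S ∪ S') = supported b S ⊔ supported b S' := by
  refine le_antisymm ?_ (sup_le (supported_mono Set.subset_union_left)
    (supported_mono Set.subset_union_right))
  rw [← Submodule.sup_orthogonal_inf_of_hasOrthogonalProjection
    (supported_mono Set.subset_union_left), orthogonal_supported, ← supported_inter]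
  refine sup_le_sup_left (supported_mono fun p hp => ?_) _
  exact hp.2.resolve_left hp.1

end Support

section MulOp

variable {X : Type*} [TopologicalSpace X] [CompactSpace X] [MeasurableSpace X] [BorelSpace X]
  (μ : Measure X) [IsFiniteMeasure μ]

lemma coeFn_holder_toLp (φ : C(X, ℂ)) (f : Lp ℂ 2 μ) :
    (ContinuousLinearMap.mul ℂ ℂ).holderL μ ⊤ 2 2 (ContinuousMap.toLp (E := ℂ) ⊤ μ ℂ φ) f =ᵐ[μ]
      fun x => φ x * f x := by
  filter_upwards [(ContinuousLinearMap.mul ℂ ℂ).coeFn_holder (r := 2)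
    (ContinuousMap.toLp (E := ℂ) ⊤ μ ℂ φ) f,
    ContinuousMap.coeFn_toLp (E := ℂ) (p := ⊤) (𝕜 := ℂ) μ φ] with x hx hφ
  exact hx.trans (congrArg (· * f x) hφ)

/-- Multiplication by continuous functions on `L²(μ)`. -/
def mulOp : C(X, ℂ) →⋆ₐ[ℂ] (Lp ℂ 2 μ →L[ℂ] Lp ℂ 2 μ) where
  toFun φ := (ContinuousLinearMap.mul ℂ ℂ).holderL μ ⊤ 2 2 (ContinuousMap.toLp (E := ℂ) ⊤ μ ℂ φ)
  map_one' := by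
    ext1 f
    refine Lp.ext ?_
    filter_upwards [coeFn_holder_toLp μ 1 f] with x hx
    exact hx.trans (one_mul _)
  map_mul' φ ψ := by
    ext1 f
    refine Lp.ext ?_
    filter_upwards [coeFn_holder_toLp μ (φ * ψ) f, coeFn_holder_toLp μ ψ f, coeFn_holder_toLp μ φ
      ((ContinuousLinearMap.mul ℂ ℂ).holderL μ ⊤ 2 2 (ContinuousMap.toLp (E := ℂ) ⊤ μ ℂ ψ) f)]
      with x h₁ h₂ h₃
    exact h₁.trans ((mul_assoc _ _ _).trans (h₃.trans (congrArg _ h₂)).symm)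
  map_zero' := by simp
  map_add' φ ψ := by simp
  commutes' a := by
    ext1 f
    refine Lp.ext ?_
    filter_upwards [coeFn_holder_toLp μ (algebraMap ℂ _ a) f, Lp.coeFn_smul a f] with x h₁ h₂
    exact h₁.trans h₂.symm
  map_star' φ := by
    rw [ContinuousLinearMap.star_eq_adjoint, ContinuousLinearMap.eq_adjoint_iff]
    intro f g
    rw [L2.inner_def, L2.inner_def]
    refine integral_congr_ae ?_
    filter_upwards [coeFn_holder_toLp μ (star φ) f, coeFn_holder_toLp μ φ g] with x hf hg
    rw [hf, hg, RCLike.inner_apply, RCLike.inner_apply, map_mul, ContinuousMap.star_apply,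
      RCLike.star_def, Complex.conj_conj, mul_left_comm, mul_assoc]

variable {μ}

lemma coeFn_mulOp (φ : C(X, ℂ)) (f : Lp ℂ 2 μ) : mulOp μ φ f =ᵐ[μ] fun x => φ x * f x :=
  coeFn_holder_toLp μ φ f

open scoped CStarAlgebra in
lemma continuous_mulOp : Continuous (mulOp (X := X) μ) := map_continuous (mulOp μ)

lemma mulOp_toLp (φ ψ : C(X, ℂ)) :
    mulOp μ φ (ContinuousMap.toLp (E := ℂ) 2 μ ℂ ψ) = ContinuousMap.toLp 2 μ ℂ (φ * ψ) := by
  refine Lp.ext ?_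
  filter_upwards [coeFn_mulOp φ (ContinuousMap.toLp (E := ℂ) 2 μ ℂ ψ),
    ContinuousMap.coeFn_toLp (E := ℂ) (p := 2) (𝕜 := ℂ) μ ψ,
    ContinuousMap.coeFn_toLp (E := ℂ) (p := 2) (𝕜 := ℂ) μ (φ * ψ)] with x h₁ h₂ h₃
  rw [h₁, h₂, h₃, ContinuousMap.mul_apply]

/-- The elements of `V` that are orthogonal to `W` in the inner product of the measure with density
`c² / |φ|²` with respect to `μ`. -/
def weightedOminus (μ : Measure X) (φ : C(X, ℂ)) (c : ℝ) (V W : Submodule ℂ (Lp ℂ 2 μ)) :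
    Set (Lp ℂ 2 μ) :=
  {f | f ∈ V ∧ ∀ g ∈ W, ∫ x, f x * starRingEnd ℂ (g x)
    ∂(μ.withDensity fun x => ENNReal.ofReal (c ^ 2 / ‖φ x‖ ^ 2)) = 0}

variable {φ ψ : C(X, ℂ)}

lemma mulOp_mulOp_of_mul_eq_one (h : φ * ψ = 1) (f : Lp ℂ 2 μ) :
    mulOp μ φ (mulOp μ ψ f) = f := by
  rw [← mul_apply_eq_comp, ← map_mul, h, map_one, one_apply_eq_self]

lemma mulOp_star_mulOp_star_of_mul_eq_one (h : φ * ψ = 1) (f : Lp ℂ 2 μ) :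
    mulOp μ (star φ) (mulOp μ (star ψ) f) = f :=
  mulOp_mulOp_of_mul_eq_one (by rw [← star_mul, mul_comm, h, star_one]) f

variable (φ ψ) in
lemma mulOp_comm (f : Lp ℂ 2 μ) : mulOp μ φ (mulOp μ ψ f) = mulOp μ ψ (mulOp μ φ f) := by
  rw [← mul_apply_eq_comp, ← map_mul, mul_comm, map_mul, mul_apply_eq_comp]

lemma integral_withDensity_eq_inner_mulOp (h : φ * ψ = 1) (c : ℝ) (f g : Lp ℂ 2 μ) :
    ∫ x, f x * starRingEnd ℂ (g x)
        ∂(μ.withDensity fun x => ENNReal.ofReal (c ^ 2 / ‖φ x‖ ^ 2)) =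
      (c : ℂ) ^ 2 * inner ℂ (mulOp μ ψ g) (mulOp μ ψ f) := by
  have hφ := φ.continuous.measurable
  rw [integral_withDensity_eq_integral_toReal_smul (by fun_prop)
    (Filter.Eventually.of_forall fun _ => ENNReal.ofReal_lt_top), L2.inner_def,
    ← integral_const_mul]
  refine integral_congr_ae ?_
  filter_upwards [coeFn_mulOp ψ f, coeFn_mulOp ψ g] with x hf hg
  have hψ : ψ x = (φ x)⁻¹ := eq_inv_of_mul_eq_one_right (DFunLike.congr_fun h x)
  have hnorm : (‖φ x‖ : ℂ) ^ 2 = φ x * starRingEnd ℂ (φ x) := (Complex.mul_conj' _).symm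
  rw [ENNReal.toReal_ofReal (by positivity), Complex.real_smul, hf, hg, hψ]
  simp only [RCLike.inner_apply, map_mul, map_inv₀]
  push_cast
  rw [hnorm]
  ring

lemma inner_mulOp_star (φ : C(X, ℂ)) (f g : Lp ℂ 2 μ) :
    inner ℂ g (mulOp μ (star φ) f) = inner ℂ (mulOp μ φ g) f := by
  rw [map_star, ContinuousLinearMap.star_eq_adjoint, ContinuousLinearMap.adjoint_inner_right]

/-- The space `V / φ` for `φ` without zeros, encoded as `{h | φ h ∈ V}`. The weighted inner
product of `f` and `g` is a multiple of the ordinary inner product of `f / φ` and `g / φ`, so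
`weightedOminus` becomes an ordinary orthogonal complement on these spaces. -/
def quotientBy (φ : C(X, ℂ)) (V : Submodule ℂ (Lp ℂ 2 μ)) : Submodule ℂ (Lp ℂ 2 μ) :=
  V.comap (mulOp μ φ : Lp ℂ 2 μ →ₗ[ℂ] Lp ℂ 2 μ)

lemma mem_quotientBy {V : Submodule ℂ (Lp ℂ 2 μ)} {h : Lp ℂ 2 μ} :
    h ∈ quotientBy φ V ↔ mulOp μ φ h ∈ V := Iff.rfl

lemma weightedOminus_eq_preimage (h : φ * ψ = 1) {c : ℝ} (hc : c ≠ 0)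
    (V W : Submodule ℂ (Lp ℂ 2 μ)) :
    weightedOminus μ φ c V W = mulOp μ ψ ⁻¹' ↑(quotientBy φ V ⊓ (quotientBy φ W)ᗮ) := by
  ext f
  have hc' : (c : ℂ) ^ 2 ≠ 0 := by simpa using hc
  have hφψ := mulOp_mulOp_of_mul_eq_one (μ := μ) h
  have hψφ := mulOp_mulOp_of_mul_eq_one (μ := μ) ((mul_comm _ _).trans h)
  simp only [weightedOminus, integral_withDensity_eq_inner_mulOp h, mul_eq_zero, hc', false_or,
    Set.mem_preimage, SetLike.mem_coe, Submodule.mem_inf, mem_quotientBy, hφψ,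
    Submodule.mem_orthogonal, Set.mem_ofPred_eq]
  refine and_congr_right fun _ => ⟨fun hf u hu => ?_, fun hf g hg => hf _ ?_⟩
  · simpa only [hψφ] using hf _ hu
  · rwa [hφψ]

lemma isClosed_quotientBy {V : Submodule ℂ (Lp ℂ 2 μ)} (hV : IsClosed (V : Set (Lp ℂ 2 μ))) :
    IsClosed (quotientBy φ V : Set (Lp ℂ 2 μ)) :=
  hV.preimage (mulOp μ φ).continuous

lemma quotientBy_inf (V W : Submodule ℂ (Lp ℂ 2 μ)) :
    quotientBy φ (V ⊓ W) = quotientBy φ V ⊓ quotientBy φ W := rfl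

lemma quotientBy_mono {V W : Submodule ℂ (Lp ℂ 2 μ)} (h : V ≤ W) :
    quotientBy φ V ≤ quotientBy φ W := Submodule.comap_mono h

lemma quotientBy_sup (h : φ * ψ = 1) (V W : Submodule ℂ (Lp ℂ 2 μ)) :
    quotientBy φ (V ⊔ W) = quotientBy φ V ⊔ quotientBy φ W := by
  refine le_antisymm (fun u hu => ?_) (sup_le (quotientBy_mono le_sup_left)
    (quotientBy_mono le_sup_right))
  obtain ⟨v, hv, w, hw, hvw⟩ := Submodule.mem_sup.mp hu
  refine Submodule.mem_sup.mpr ⟨mulOp μ ψ v, ?_, mulOp μ ψ w, ?_, ?_⟩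
  · rwa [mem_quotientBy, mulOp_mulOp_of_mul_eq_one h]
  · rwa [mem_quotientBy, mulOp_mulOp_of_mul_eq_one h]
  · rw [← map_add, hvw]
    exact mulOp_mulOp_of_mul_eq_one ((mul_comm _ _).trans h) u

end MulOp

section PolydiskAlgebra

variable {d : Type*}

/-- The restrictions of complex polynomials to the torus. -/
def polyMap : MvPolynomial d ℂ →ₐ[ℂ] C(UnitAddTorus d, ℂ) :=
  MvPolynomial.aeval fun i => ⟨fun x => (x i).toCircle, by fun_prop⟩

lemma polyMap_apply (q : MvPolynomial d ℂ) (x : UnitAddTorus d) :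
    polyMap q x = MvPolynomial.eval (fun i => ((x i).toCircle : ℂ)) q := by
  have h : (ContinuousMap.evalAlgHom ℂ ℂ x).comp polyMap =
      MvPolynomial.aeval fun i => ((x i).toCircle : ℂ) :=
    MvPolynomial.algHom_ext fun i => by simp [polyMap]
  rw [← MvPolynomial.coe_aeval_eq_eval]
  exact DFunLike.congr_fun h q

/-- The polydisk algebra, as an algebra of functions on the torus: its elements are the boundary
values of the continuous functions on the closed polydisk that are holomorphic inside. -/
def polydiskAlgebra (d : Type*) : Subalgebra ℂ C(UnitAddTorus d, ℂ) :=
  (polyMap (d := d)).range.topologicalClosure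

lemma polyMap_mem_polydiskAlgebra (q : MvPolynomial d ℂ) : polyMap q ∈ polydiskAlgebra d :=
  Subalgebra.le_topologicalClosure _ ⟨q, rfl⟩

lemma isUnit_algHom_apply {σ A : Type*} [NormedCommRing A] [NormedAlgebra ℂ A] [CompleteSpace A]
    [NormOneClass A] (P : MvPolynomial σ ℂ →ₐ[ℂ] A) (hP : ∀ i, ‖P (MvPolynomial.X i)‖ ≤ 1)
    {q : MvPolynomial σ ℂ}
    (hq : ∀ v : σ → ℂ, (∀ i, ‖v i‖ ≤ 1) → MvPolynomial.eval v q ≠ 0) : IsUnit (P q) := by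
  -- A character that kills `P q` would evaluate `q` at a zero in the closed polydisk.
  by_contra h
  obtain ⟨χ, hχ⟩ := WeakDual.CharacterSpace.exists_apply_eq_zero h
  let F : A →ₐ[ℂ] ℂ := WeakDual.CharacterSpace.equivAlgHom χ
  have hF : F.comp P = MvPolynomial.aeval fun i => F (P (MvPolynomial.X i)) :=
    MvPolynomial.algHom_ext fun i => by simp
  refine hq (fun i => F (P (MvPolynomial.X i)))
    (fun i => (AlgHom.norm_apply_le_self F _).trans (hP i)) ?_
  rw [← MvPolynomial.coe_aeval_eq_eval]
  exact (DFunLike.congr_fun hF q).symm.trans hχ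

lemma exists_inv_mem_polydiskAlgebra {q : MvPolynomial d ℂ}
    (hq : ∀ v : d → ℂ, (∀ i, ‖v i‖ ≤ 1) → MvPolynomial.eval v q ≠ 0) :
    ∃ r ∈ polydiskAlgebra d, polyMap q * r = 1 := by
  have : CompleteSpace (polydiskAlgebra d) :=
    (Subalgebra.isClosed_topologicalClosure _).completeSpace_coe
  have : NormOneClass (polydiskAlgebra d) := ⟨norm_one (α := C(UnitAddTorus d, ℂ))⟩
  let P : MvPolynomial d ℂ →ₐ[ℂ] polydiskAlgebra d :=
    polyMap.codRestrict _ polyMap_mem_polydiskAlgebra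
  have hP (i : d) : ‖P (MvPolynomial.X i)‖ ≤ 1 := by
    change ‖polyMap (MvPolynomial.X i)‖ ≤ 1
    refine (ContinuousMap.norm_le _ zero_le_one).mpr fun x => ?_
    rw [polyMap_apply, MvPolynomial.eval_X, Circle.norm_coe]
  obtain ⟨r, hr⟩ := (isUnit_algHom_apply (A := polydiskAlgebra d) P hP hq).exists_right_inv
  exact ⟨r, r.2, congrArg Subtype.val hr⟩

end PolydiskAlgebra

section Torus

open UnitAddTorus

variable {d : Type*} [Fintype d]

/-- Normalized Lebesgue measure on the torus `𝕋ᵈ`. -/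
abbrev torusMeasure (d : Type*) [Fintype d] : Measure (UnitAddTorus d) :=
  Measure.pi fun _ => AddCircle.haarAddCircle

/-- The Hilbert basis of `L²(𝕋ᵈ)` formed by the characters. -/
def fourierBasis : HilbertBasis (d → ℤ) ℂ (Lp ℂ 2 (torusMeasure d)) := mFourierBasis

lemma fourierBasis_apply (p : d → ℤ) :
    fourierBasis p = ContinuousMap.toLp (E := ℂ) 2 (torusMeasure d) ℂ (mFourier p) :=
  congrFun coe_mFourierBasis p

lemma star_mFourier (p : d → ℤ) : star (mFourier p) = mFourier (-p) := by
  ext x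
  exact (mFourier_neg (n := p) (x := x)).symm

lemma mulOp_mFourier_fourierBasis (e p : d → ℤ) :
    mulOp (torusMeasure d) (mFourier e) (fourierBasis p) = fourierBasis (e + p) := by
  rw [fourierBasis_apply, fourierBasis_apply, mulOp_toLp]
  congr 1
  ext x
  exact mFourier_add.symm

lemma repr_mulOp_mFourier (e p : d → ℤ) (f : Lp ℂ 2 (torusMeasure d)) :
    fourierBasis.repr (mulOp (torusMeasure d) (mFourier e) f) p = fourierBasis.repr f (p - e) := by
  rw [← neg_neg e, ← star_mFourier, HilbertBasis.repr_apply_apply, inner_mulOp_star,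
    mulOp_mFourier_fourierBasis, HilbertBasis.repr_apply_apply, sub_neg_eq_add, add_comm]

/-- The continuous functions on the torus that multiply functions with Fourier support in `S` into
functions with Fourier support in `S'`. -/
def multipliers (S S' : Set (d → ℤ)) : Submodule ℂ C(UnitAddTorus d, ℂ) where
  carrier := {φ | ∀ f ∈ supported fourierBasis S,
    mulOp (torusMeasure d) φ f ∈ supported fourierBasis S'}
  add_mem' hφ hψ f hf := by
    rw [map_add]
    exact add_mem (hφ f hf) (hψ f hf)
  zero_mem' f _ := by
    rw [map_zero]
    exact zero_mem _
  smul_mem' a φ hφ f hf := by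
    rw [map_smul]
    exact Submodule.smul_mem _ a (hφ f hf)

variable {S S' : Set (d → ℤ)} {φ : C(UnitAddTorus d, ℂ)}

lemma isClosed_multipliers : IsClosed (multipliers S S' : Set C(UnitAddTorus d, ℂ)) := by
  change IsClosed {φ | ∀ f ∈ supported fourierBasis S, mulOp _ φ f ∈ supported fourierBasis S'}
  simp only [Set.ofPred_forall]
  exact isClosed_iInter fun f => isClosed_iInter fun _ =>
    (isClosed_supported _ S').preimage (continuous_mulOp.clm_apply continuous_const)

lemma star_mem_multipliers (hφ : φ ∈ multipliers S S') : star φ ∈ multipliers S'ᶜ Sᶜ := by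
  intro f hf
  rw [← orthogonal_supported] at hf ⊢
  intro g hg
  rw [inner_mulOp_star]
  exact hf _ (hφ g hg)

lemma mFourier_mem_multipliers {e : d → ℤ} (h : ∀ p ∈ S, p + e ∈ S') :
    mFourier e ∈ multipliers S S' := by
  intro f hf p hp
  rw [repr_mulOp_mFourier]
  refine hf _ fun hpS => hp ?_
  simpa only [sub_add_cancel] using h _ hpS

lemma polyMap_monomial (e : d →₀ ℕ) (a : ℂ) :
    polyMap (MvPolynomial.monomial e a) = a • mFourier (fun i => (e i : ℤ)) := by
  ext x
  rw [polyMap_apply, MvPolynomial.eval_monomial, Finsupp.prod_fintype _ _ fun _ => pow_zero _]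
  simp [mFourier, fourier_apply, AddCircle.toCircle_nsmul]

lemma polyMap_mem_multipliers {q : MvPolynomial d ℂ}
    (h : ∀ e ∈ q.support, ∀ p ∈ S, p + (fun i => (e i : ℤ)) ∈ S') :
    polyMap q ∈ multipliers S S' := by
  rw [q.as_sum, map_sum]
  refine Submodule.sum_mem _ fun e he => ?_
  rw [polyMap_monomial]
  exact Submodule.smul_mem _ _ (mFourier_mem_multipliers (h e he))

lemma mem_multipliers_of_isUpperSet (hS : IsUpperSet S) (hφ : φ ∈ polydiskAlgebra d) :
    φ ∈ multipliers S S := by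
  refine closure_minimal (s := ((polyMap (d := d)).range : Set C(UnitAddTorus d, ℂ))) ?_
    isClosed_multipliers hφ
  rintro _ ⟨q, rfl⟩
  exact polyMap_mem_multipliers fun e _ p hp =>
    hS (le_add_of_nonneg_right fun i => Int.natCast_nonneg (e i)) hp

lemma star_mem_multipliers_of_isLowerSet (hS : IsLowerSet S) (hφ : φ ∈ polydiskAlgebra d) :
    star φ ∈ multipliers S S := by
  simpa only [compl_compl] using
    star_mem_multipliers (mem_multipliers_of_isUpperSet hS.compl hφ)

end Torus

section Quadrant

open MvPolynomial

variable {d : Type*} [Fintype d] (i j : d)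

/-- The functions in `L²(𝕋ᵈ)` whose Fourier support consists of frequencies `p` with
`(p i, p j) ∈ A`; for `d = Fin 2` these are the closed spans of monomials. -/
def quadrantSpace (A : Set (ℕ × ℕ)) : Submodule ℂ (Lp ℂ 2 (torusMeasure d)) :=
  supported fourierBasis {p | ∃ s ∈ A, p i = s.1 ∧ p j = s.2}

instance (φ : C(UnitAddTorus d, ℂ)) (A : Set (ℕ × ℕ)) :
    (quotientBy φ (quadrantSpace i j A)).HasOrthogonalProjection :=
  have := (isClosed_quotientBy (φ := φ) (isClosed_supported fourierBasis
    {p : d → ℤ | ∃ s ∈ A, p i = s.1 ∧ p j = s.2})).completeSpace_coe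
  inferInstanceAs (quotientBy φ (supported fourierBasis
    {p | ∃ s ∈ A, p i = s.1 ∧ p j = s.2})).HasOrthogonalProjection

lemma quadrantSpace_mono {A A' : Set (ℕ × ℕ)} (h : A ⊆ A') :
    quadrantSpace i j A ≤ quadrantSpace i j A' :=
  supported_mono fun _ ⟨s, hs, hp⟩ => ⟨s, h hs, hp⟩

lemma quadrantSpace_inter (A A' : Set (ℕ × ℕ)) :
    quadrantSpace i j (A ∩ A') = quadrantSpace i j A ⊓ quadrantSpace i j A' := by
  rw [quadrantSpace, quadrantSpace, quadrantSpace, ← supported_inter]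
  congr 1
  ext p
  constructor
  · rintro ⟨s, ⟨hs, hs'⟩, hp⟩
    exact ⟨⟨s, hs, hp⟩, s, hs', hp⟩
  · rintro ⟨⟨s, hs, hp⟩, s', hs', hp'⟩
    obtain rfl : s = s' := by ext <;> lia
    exact ⟨s, ⟨hs, hs'⟩, hp⟩

lemma quadrantSpace_union (A A' : Set (ℕ × ℕ)) :
    quadrantSpace i j (A ∪ A') = quadrantSpace i j A ⊔ quadrantSpace i j A' := by
  rw [quadrantSpace, quadrantSpace, quadrantSpace, ← supported_union]
  congr 1
  ext p
  simp only [Set.mem_union, or_and_right, exists_or, Set.mem_ofPred_eq]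

variable {i j} in
lemma quadrantSpace_swap {A A' : Set (ℕ × ℕ)} (h : ∀ a b, (a, b) ∈ A ↔ (b, a) ∈ A') :
    quadrantSpace j i A = quadrantSpace i j A' := by
  rw [quadrantSpace, quadrantSpace]
  congr 1
  ext p
  constructor
  · rintro ⟨s, hs, hj, hi⟩
    exact ⟨s.swap, (h _ _).mp hs, hi, hj⟩
  · rintro ⟨s, hs, hi, hj⟩
    exact ⟨s.swap, (h _ _).mpr hs, hj, hi⟩

variable {i j} {n m : ℕ} {q : MvPolynomial d ℂ} {r : C(UnitAddTorus d, ℂ)}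

lemma mem_supported_compl_of_star_mulOp_mem (hqm : degreeOf j q ≤ m) (hr : r ∈ polydiskAlgebra d)
    (hqr : polyMap q * r = 1) {f : Lp ℂ 2 (torusMeasure d)}
    (hf : f ∈ supported fourierBasis {p | 0 ≤ p i ∧ 0 ≤ p j ∧ p j < m}ᶜ)
    (hqf : mulOp (torusMeasure d) (star (polyMap q)) f ∈ supported fourierBasis {p | 0 ≤ p j}) :
    f ∈ supported fourierBasis {p | 0 ≤ p i ∧ p j < m}ᶜ := by
  have hsplit : {p : d → ℤ | 0 ≤ p i ∧ 0 ≤ p j ∧ p j < m}ᶜ ⊆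
      {p | 0 ≤ p i ∧ p j < 0} ∪ {p | 0 ≤ p i ∧ p j < (m : ℤ)}ᶜ := by
    intro p hp
    simp only [Set.mem_compl_iff, Set.mem_union, Set.mem_ofPred_eq] at hp ⊢
    lia
  have hf_union := supported_mono hsplit hf
  rw [supported_union] at hf_union
  obtain ⟨g, hg, f', hf', rfl⟩ := Submodule.mem_sup.mp hf_union
  suffices g = 0 by rwa [this, zero_add]
  have hqf' : mulOp _ (star (polyMap q)) f' ∈
      supported fourierBasis {p | 0 ≤ p i ∧ p j < 0}ᶜ := by
    refine star_mem_multipliers (polyMap_mem_multipliers fun e he p hp => ?_) f' hf'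
    have hej := (monomial_le_degreeOf j he).trans hqm
    simp only [Set.mem_ofPred_eq, Pi.add_apply] at hp ⊢
    lia
  have hqg_j : mulOp _ (star (polyMap q)) g ∈ supported fourierBasis {p | p j < 0} :=
    star_mem_multipliers_of_isLowerSet (fun _ _ hle hp => (hle j).trans_lt hp)
      (polyMap_mem_polydiskAlgebra q) g (supported_mono (fun _ hp => hp.2) hg)
  have hqg : mulOp _ (star (polyMap q)) g ∈
      supported fourierBasis ({p | 0 ≤ p j} ∪ {p | 0 ≤ p i ∧ p j < 0}ᶜ) := by
    rw [← add_sub_cancel_right g f', map_sub, supported_union]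
    exact sub_mem (Submodule.mem_sup_left hqf) (Submodule.mem_sup_right hqf')
  have hqg_i : mulOp _ (star (polyMap q)) g ∈ supported fourierBasis {p | p i < 0} := by
    refine mem_supported_of_inter_subset _ hqg hqg_j fun p hp => ?_
    simp only [Set.mem_inter_iff, Set.mem_union, Set.mem_compl_iff, Set.mem_ofPred_eq] at hp ⊢
    lia
  have hg_i : g ∈ supported fourierBasis {p | p i < 0} := by
    rw [← mulOp_star_mulOp_star_of_mul_eq_one ((mul_comm _ _).trans hqr) g]
    exact star_mem_multipliers_of_isLowerSet (fun _ _ hle hp => (hle i).trans_lt hp) hr _ hqg_i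
  rw [← Submodule.mem_bot ℂ, ← supported_empty fourierBasis]
  exact mem_supported_of_inter_subset _ hg hg_i fun p hp => (hp.1.1.not_gt hp.2).elim

lemma star_mulOp_mem_supported_halfStrip_compl (hqr : polyMap q * r = 1)
    {h : Lp ℂ 2 (torusMeasure d)}
    (hh : h ∈ (quotientBy (polyMap q) (quadrantSpace i j {p | p.2 < m}))ᗮ) :
    mulOp (torusMeasure d) (star r) h ∈
      supported fourierBasis {p | 0 ≤ p i ∧ 0 ≤ p j ∧ p j < m}ᶜ := by
  intro p hp
  obtain ⟨hi, hj, hjm⟩ := not_not.mp hp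
  rw [HilbertBasis.repr_apply_apply, inner_mulOp_star]
  refine hh _ ?_
  rw [mem_quotientBy, mulOp_mulOp_of_mul_eq_one hqr]
  refine basis_mem_supported ⟨((p i).toNat, (p j).toNat), ?_, ?_⟩
  · exact (Int.toNat_lt hj).mpr hjm
  · exact ⟨(Int.toNat_of_nonneg hi).symm, (Int.toNat_of_nonneg hj).symm⟩

lemma quotientBy_border_inf_orthogonal_le (hqn : degreeOf i q ≤ n) (hqm : degreeOf j q ≤ m)
    (hr : r ∈ polydiskAlgebra d) (hqr : polyMap q * r = 1) :
    quotientBy (polyMap q) (quadrantSpace i j {p | p.1 < n ∨ p.2 < m}) ⊓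
        (quotientBy (polyMap q) (quadrantSpace i j {p | p.2 < m}))ᗮ ≤
      quotientBy (polyMap q) (quadrantSpace i j {p | p.1 < n}) := by
  rintro h ⟨hh, horth⟩
  set f := mulOp (torusMeasure d) (star r) h with hf_def
  have hqf : mulOp _ (star (polyMap q)) f = h :=
    mulOp_star_mulOp_star_of_mul_eq_one hqr h
  have hh_j : h ∈ supported fourierBasis {p | 0 ≤ p j} := by
    rw [← mulOp_mulOp_of_mul_eq_one ((mul_comm _ _).trans hqr) h]
    refine mem_multipliers_of_isUpperSet (fun _ _ hle hp => hp.trans (hle j)) hr _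
      (supported_mono ?_ hh)
    rintro p ⟨s, -, -, hj⟩
    exact hj.ge.trans' (Int.natCast_nonneg s.2)
  have hf : f ∈ supported fourierBasis {p | 0 ≤ p i ∧ p j < m}ᶜ :=
    mem_supported_compl_of_star_mulOp_mem hqm hr hqr
      (star_mulOp_mem_supported_halfStrip_compl hqr horth) (hqf.symm ▸ hh_j)
  have hqf_shift : mulOp _ (polyMap q) f ∈ supported fourierBasis {p | p i < n ∨ m ≤ p j} := by
    refine polyMap_mem_multipliers (fun e he p hp => ?_) f hf
    have hei := (monomial_le_degreeOf i he).trans hqn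
    simp only [Set.mem_compl_iff, Set.mem_ofPred_eq, Pi.add_apply] at hp ⊢
    lia
  have hqf_border : mulOp _ (polyMap q) f ∈ supported fourierBasis {p | p i < n ∨ p j < m} := by
    rw [hf_def, mulOp_comm]
    refine star_mem_multipliers_of_isLowerSet (fun _ _ hle hp => hp.imp (hle i).trans_lt
      (hle j).trans_lt) hr _ (supported_mono ?_ hh)
    rintro p ⟨s, hs, hi, hj⟩
    simpa [hi, hj] using hs
  have hqf_i : mulOp _ (polyMap q) f ∈ supported fourierBasis {p | p i < n} :=
    mem_supported_of_inter_subset _ hqf_shift hqf_border fun p hp => by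
      simp only [Set.mem_inter_iff, Set.mem_ofPred_eq] at hp ⊢
      lia
  have hqh_i : mulOp _ (polyMap q) h ∈ supported fourierBasis {p | p i < n} := by
    rw [← hqf, mulOp_comm]
    exact star_mem_multipliers_of_isLowerSet (fun _ _ hle hp => (hle i).trans_lt hp)
      (polyMap_mem_polydiskAlgebra q) _ hqf_i
  refine mem_supported_of_inter_subset _ hh hqh_i ?_
  rintro p ⟨⟨s, -, hi, hj⟩, hp⟩
  exact ⟨s, by simpa [hi] using hp, hi, hj⟩

lemma border_inf_orthogonal_eq (hqn : degreeOf i q ≤ n) (hqm : degreeOf j q ≤ m)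
    (hr : r ∈ polydiskAlgebra d) (hqr : polyMap q * r = 1) :
    quotientBy (polyMap q) (quadrantSpace i j {p | p.1 < n ∨ p.2 < m}) ⊓
        (quotientBy (polyMap q) (quadrantSpace i j {p | p.2 < m}))ᗮ =
      quotientBy (polyMap q) (quadrantSpace i j {p | p.1 < n}) ⊓
        (quotientBy (polyMap q) (quadrantSpace i j {p | p.1 < n ∧ p.2 < m}))ᗮ := by
  rw [inf_orthogonal_eq_inf_orthogonal_inf
    (quotientBy_mono (quadrantSpace_mono i j fun _ => .inr))
    (quotientBy_mono (quadrantSpace_mono i j fun _ => .inl))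
    (quotientBy_border_inf_orthogonal_le hqn hqm hr hqr), ← quotientBy_inf,
    ← quadrantSpace_inter, Set.inter_comm]
  rfl

lemma box_inf_orthogonal_eq (hqn : degreeOf i q ≤ n) (hqm : degreeOf j q ≤ m)
    (hr : r ∈ polydiskAlgebra d) (hqr : polyMap q * r = 1) :
    quotientBy (polyMap q) (quadrantSpace i j {p | p.1 ≤ n ∧ p.2 ≤ m ∧ p ≠ (n, m)}) ⊓
        (quotientBy (polyMap q) (quadrantSpace i j {p | p.1 ≤ n ∧ p.2 < m}))ᗮ =
      quotientBy (polyMap q) (quadrantSpace i j {p | p.1 < n ∧ p.2 ≤ m}) ⊓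
        (quotientBy (polyMap q) (quadrantSpace i j {p | p.1 < n ∧ p.2 < m}))ᗮ := by
  have hbox : {p : ℕ × ℕ | p.1 ≤ n ∧ p.2 ≤ m ∧ p ≠ (n, m)} =
      {p | p.1 < n ∧ p.2 ≤ m} ∪ {p | p.1 ≤ n ∧ p.2 < m} := by
    ext ⟨a, b⟩
    simp only [Set.mem_union, Set.mem_ofPred_eq, ne_eq, Prod.mk.injEq]
    lia
  rw [hbox, quadrantSpace_union, quotientBy_sup hqr]
  refine sup_inf_orthogonal_eq_inf_orthogonal
    (quotientBy_mono (quadrantSpace_mono i j fun _ hp => ⟨hp.1.le, hp.2⟩))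
    (quotientBy_mono (quadrantSpace_mono i j fun _ hp => ⟨hp.1, hp.2.le⟩)) ?_
  calc _ ≤ quotientBy (polyMap q) (quadrantSpace i j {p | p.1 < n}) ⊓
          (quotientBy (polyMap q) (quadrantSpace i j {p | p.1 < n ∧ p.2 < m}))ᗮ :=
        inf_le_inf_right _ (quotientBy_mono (quadrantSpace_mono i j fun _ hp => hp.1))
    _ ≤ (quotientBy (polyMap q) (quadrantSpace i j {p | p.2 < m}))ᗮ :=
        (border_inf_orthogonal_eq hqn hqm hr hqr).ge.trans inf_le_right
    _ ≤ _ := Submodule.orthogonal_le (quotientBy_mono (quadrantSpace_mono i j fun _ hp => hp.2))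

lemma weightedOminus_border_eq (hqn : degreeOf i q ≤ n) (hqm : degreeOf j q ≤ m)
    (hq : ∀ v : d → ℂ, (∀ k, ‖v k‖ ≤ 1) → eval v q ≠ 0) {c : ℝ} (hc : c ≠ 0) :
    weightedOminus (torusMeasure d) (polyMap q) c
        (quadrantSpace i j {p | p.1 < n ∨ p.2 < m}) (quadrantSpace i j {p | p.2 < m}) =
      weightedOminus (torusMeasure d) (polyMap q) c
        (quadrantSpace i j {p | p.1 < n}) (quadrantSpace i j {p | p.1 < n ∧ p.2 < m}) := by
  obtain ⟨r, hr, hqr⟩ := exists_inv_mem_polydiskAlgebra hq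
  rw [weightedOminus_eq_preimage hqr hc, weightedOminus_eq_preimage hqr hc,
    border_inf_orthogonal_eq hqn hqm hr hqr]

lemma weightedOminus_box_eq (hqn : degreeOf i q ≤ n) (hqm : degreeOf j q ≤ m)
    (hq : ∀ v : d → ℂ, (∀ k, ‖v k‖ ≤ 1) → eval v q ≠ 0) {c : ℝ} (hc : c ≠ 0) :
    weightedOminus (torusMeasure d) (polyMap q) c
        (quadrantSpace i j {p | p.1 ≤ n ∧ p.2 ≤ m ∧ p ≠ (n, m)})
        (quadrantSpace i j {p | p.1 ≤ n ∧ p.2 < m}) =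
      weightedOminus (torusMeasure d) (polyMap q) c
        (quadrantSpace i j {p | p.1 < n ∧ p.2 ≤ m})
        (quadrantSpace i j {p | p.1 < n ∧ p.2 < m}) := by
  obtain ⟨r, hr, hqr⟩ := exists_inv_mem_polydiskAlgebra hq
  rw [weightedOminus_eq_preimage hqr hc, weightedOminus_eq_preimage hqr hc,
    box_inf_orthogonal_eq hqn hqm hr hqr]

end Quadrant

section MonomialSpan

open UnitAddTorus

lemma monomialL2_eq_fourierBasis (j k : ℕ) : monomialL2 j k = fourierBasis ![(j : ℤ), (k : ℤ)] := by
  rw [fourierBasis_apply, monomialL2]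
  congr 1
  ext x
  simp [monomialMap, torusPoint, mFourier, fourier_apply, AddCircle.toCircle_nsmul]

lemma monomialSpan_eq_span (A : Set (ℕ × ℕ)) : monomialSpan A = Submodule.span ℂ
    (fourierBasis '' {p : Fin 2 → ℤ | ∃ s ∈ A, p 0 = s.1 ∧ p 1 = s.2}) := by
  rw [monomialSpan]
  congr 1
  ext f
  constructor
  · rintro ⟨s, hs, rfl⟩
    exact ⟨_, ⟨s, hs, rfl, rfl⟩, (monomialL2_eq_fourierBasis s.1 s.2).symm⟩
  · rintro ⟨p, ⟨s, hs, h₀, h₁⟩, rfl⟩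
    exact ⟨s, hs, (monomialL2_eq_fourierBasis s.1 s.2).trans
      (congrArg _ (funext (Fin.forall_fin_two.mpr ⟨h₀.symm, h₁.symm⟩)))⟩

lemma monomialClosedSpan_eq_quadrantSpace (A : Set (ℕ × ℕ)) :
    monomialClosedSpan A = quadrantSpace 0 1 A := by
  rw [monomialClosedSpan, monomialSpan_eq_span, quadrantSpace, supported_eq_topologicalClosure_span]

lemma monomialSpan_eq_quadrantSpace {A : Set (ℕ × ℕ)} (hA : A.Finite) :
    monomialSpan A = quadrantSpace 0 1 A := by
  have : FiniteDimensional ℂ (monomialSpan A) := .span_of_finite ℂ (hA.image _)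
  rw [← monomialClosedSpan_eq_quadrantSpace, monomialClosedSpan,
    (monomialSpan A).closed_of_finiteDimensional.submodule_topologicalClosure_eq]

lemma boxNoCorner_eq_quadrantSpace (n m : ℕ) :
    boxNoCorner n m = quadrantSpace 0 1 {p | p.1 ≤ n ∧ p.2 ≤ m ∧ p ≠ (n, m)} :=
  monomialSpan_eq_quadrantSpace ((Set.finite_Iic (n, m)).subset fun _ hp => ⟨hp.1, hp.2.1⟩)

lemma boxNoTop_eq_quadrantSpace (n m : ℕ) :
    boxNoTop n m = quadrantSpace 0 1 {p | p.1 ≤ n ∧ p.2 < m} :=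
  monomialSpan_eq_quadrantSpace ((Set.finite_Iic (n, m)).subset fun _ hp => ⟨hp.1, hp.2.le⟩)

lemma boxNoRight_eq_quadrantSpace (n m : ℕ) :
    boxNoRight n m = quadrantSpace 0 1 {p | p.1 < n ∧ p.2 ≤ m} :=
  monomialSpan_eq_quadrantSpace ((Set.finite_Iic (n, m)).subset fun _ hp => ⟨hp.1.le, hp.2⟩)

lemma boxSmall_eq_quadrantSpace (n m : ℕ) :
    boxSmall n m = quadrantSpace 0 1 {p | p.1 < n ∧ p.2 < m} :=
  monomialSpan_eq_quadrantSpace ((Set.finite_Iic (n, m)).subset fun _ hp => ⟨hp.1.le, hp.2.le⟩)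

lemma ominus_bsMeasure (q : MvPolynomial (Fin 2) ℂ) (c : ℝ) (V W : Submodule ℂ L2) :
    ominus (bsMeasure q c) V W = weightedOminus (torusMeasure (Fin 2)) (polyMap q) c V W := by
  simp only [weightedOminus, polyMap_apply]
  rfl

end MonomialSpan

end BernsteinSzego

end

open MvPolynomial BernsteinSzego

theorem mainTheorem3_general {d : Type*} [Fintype d] {i j : d} {n m : ℕ} {q : MvPolynomial d ℂ}
    (hqn : degreeOf i q ≤ n) (hqm : degreeOf j q ≤ m)
    (hq : ∀ v : d → ℂ, (∀ k, ‖v k‖ ≤ 1) → eval v q ≠ 0) {c : ℝ} (hc : c ≠ 0) :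
    weightedOminus (torusMeasure d) (polyMap q) c
        (quadrantSpace i j {p | p.1 < n ∨ p.2 < m}) (quadrantSpace i j {p | p.2 < m}) =
      weightedOminus (torusMeasure d) (polyMap q) c
        (quadrantSpace i j {p | p.1 < n}) (quadrantSpace i j {p | p.1 < n ∧ p.2 < m}) ∧
    weightedOminus (torusMeasure d) (polyMap q) c
        (quadrantSpace i j {p | p.1 < n ∨ p.2 < m}) (quadrantSpace i j {p | p.1 < n}) =
      weightedOminus (torusMeasure d) (polyMap q) c
        (quadrantSpace i j {p | p.2 < m}) (quadrantSpace i j {p | p.1 < n ∧ p.2 < m}) ∧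
    weightedOminus (torusMeasure d) (polyMap q) c
        (quadrantSpace i j {p | p.1 ≤ n ∧ p.2 ≤ m ∧ p ≠ (n, m)})
        (quadrantSpace i j {p | p.1 ≤ n ∧ p.2 < m}) =
      weightedOminus (torusMeasure d) (polyMap q) c
        (quadrantSpace i j {p | p.1 < n ∧ p.2 ≤ m})
        (quadrantSpace i j {p | p.1 < n ∧ p.2 < m}) ∧
    weightedOminus (torusMeasure d) (polyMap q) c
        (quadrantSpace i j {p | p.1 ≤ n ∧ p.2 ≤ m ∧ p ≠ (n, m)})
        (quadrantSpace i j {p | p.1 < n ∧ p.2 ≤ m}) =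
      weightedOminus (torusMeasure d) (polyMap q) c
        (quadrantSpace i j {p | p.1 ≤ n ∧ p.2 < m})
        (quadrantSpace i j {p | p.1 < n ∧ p.2 < m}) := by
  have hborder := weightedOminus_border_eq hqm hqn hq hc
  have hbox := weightedOminus_box_eq hqm hqn hq hc
  rw [quadrantSpace_swap (A := {p | p.1 < m ∨ p.2 < n}) (A' := {p | p.1 < n ∨ p.2 < m})
      fun _ _ => or_comm,
    quadrantSpace_swap (A := {p | p.2 < n}) (A' := {p | p.1 < n}) fun _ _ => Iff.rfl,
    quadrantSpace_swap (A := {p | p.1 < m}) (A' := {p | p.2 < m}) fun _ _ => Iff.rfl,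
    quadrantSpace_swap (A := {p | p.1 < m ∧ p.2 < n}) (A' := {p | p.1 < n ∧ p.2 < m})
      fun _ _ => and_comm] at hborder
  rw [quadrantSpace_swap (A := {p | p.1 ≤ m ∧ p.2 ≤ n ∧ p ≠ (m, n)})
      (A' := {p | p.1 ≤ n ∧ p.2 ≤ m ∧ p ≠ (n, m)}) fun _ _ => by simp [and_left_comm, and_comm],
    quadrantSpace_swap (A := {p | p.1 ≤ m ∧ p.2 < n}) (A' := {p | p.1 < n ∧ p.2 ≤ m})
      fun _ _ => and_comm,
    quadrantSpace_swap (A := {p | p.1 < m ∧ p.2 ≤ n}) (A' := {p | p.1 ≤ n ∧ p.2 < m})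
      fun _ _ => and_comm,
    quadrantSpace_swap (A := {p | p.1 < m ∧ p.2 < n}) (A' := {p | p.1 < n ∧ p.2 < m})
      fun _ _ => and_comm] at hbox
  exact ⟨weightedOminus_border_eq hqn hqm hq hc, hborder,
    weightedOminus_box_eq hqn hqm hq hc, hbox⟩

theorem mainTheorem3 (n m : ℕ) (hn : 0 < n) (hm : 0 < m)
    (q : MvPolynomial (Fin 2) ℂ)
    (hqn : MvPolynomial.degreeOf 0 q ≤ n) (hqm : MvPolynomial.degreeOf 1 q ≤ m)
    (hq : ∀ z w : ℂ, ‖z‖ ≤ 1 → ‖w‖ ≤ 1 → MvPolynomial.eval ![z, w] q ≠ 0)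
    (c : ℝ) (hc : 0 < c)
    (hμ : MeasureTheory.IsProbabilityMeasure (BernsteinSzego.bsMeasure q c)) :
    BernsteinSzego.ominus (BernsteinSzego.bsMeasure q c)
        (BernsteinSzego.border n m) (BernsteinSzego.bottomBorder m) ⊆
      BernsteinSzego.ominus (BernsteinSzego.bsMeasure q c)
        (BernsteinSzego.leftBorder n) (BernsteinSzego.boxSmall n m) ∧
    BernsteinSzego.ominus (BernsteinSzego.bsMeasure q c)
        (BernsteinSzego.border n m) (BernsteinSzego.leftBorder n) ⊆
      BernsteinSzego.ominus (BernsteinSzego.bsMeasure q c)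
        (BernsteinSzego.bottomBorder m) (BernsteinSzego.boxSmall n m) ∧
    BernsteinSzego.ominus (BernsteinSzego.bsMeasure q c)
        (BernsteinSzego.boxNoCorner n m) (BernsteinSzego.boxNoTop n m) =
      BernsteinSzego.ominus (BernsteinSzego.bsMeasure q c)
        (BernsteinSzego.boxNoRight n m) (BernsteinSzego.boxSmall n m) ∧
    BernsteinSzego.ominus (BernsteinSzego.bsMeasure q c)
        (BernsteinSzego.boxNoCorner n m) (BernsteinSzego.boxNoRight n m) =
      BernsteinSzego.ominus (BernsteinSzego.bsMeasure q c)
        (BernsteinSzego.boxNoTop n m) (BernsteinSzego.boxSmall n m) := by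
  have hqv (v : Fin 2 → ℂ) (hv : ∀ k, ‖v k‖ ≤ 1) : eval v q ≠ 0 := by
    rw [show v = ![v 0, v 1] from funext (Fin.forall_fin_two.mpr ⟨rfl, rfl⟩)]
    exact hq _ _ (hv 0) (hv 1)
  obtain ⟨hbottom, hleft, htop, hright⟩ :=
    mainTheorem3_general (i := 0) (j := 1) hqn hqm hqv hc.ne'
  simp only [ominus_bsMeasure, border, bottomBorder, leftBorder,
    monomialClosedSpan_eq_quadrantSpace, boxNoCorner_eq_quadrantSpace, boxNoTop_eq_quadrantSpace,
    boxNoRight_eq_quadrantSpace, boxSmall_eq_quadrantSpace]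
  exact ⟨hbottom.subset, hleft.subset, htop, hright⟩
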